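/- Let $V$ be a separable reflexive real Banach space with dual $V^*$, and let $T>0$. Let $\mathcal E:[0,T]\times V\to(-\infty,+\infty]$ have domain $[0,T]\times D$ for some $D\subset V$, write $\mathcal G(u)=\sup_{t\in[0,T]}\mathcal E_t(u)$, let $\mathrm F:[0,T]\times D\rightrightarrows V^*$ be a multivalued map with graph $\{(t,u,\xi):\xi\in \mathrm F_t(u)\}$, let $\mathrm P:\mathrm{graph}(\mathrm F)\to\mathbb R$, and let $\Psi_u:V\to[0,+\infty)$, $u\in D$, be functions with Fenchel conjugates $\Psi_u^*$ and convex subdifferentials $\partial\Psi_u$. Assume on $\Psi$: (i) for every $u\in D$, $\Psi_u$ is convex and lower semicontinuous, $\Psi_u(0)=0$, $\Psi_u(v)/\|v\|\to+\infty$ as $\|v\|\to\infty$, $\Psi_u^*(\xi)/\|\xi\|_*\to+\infty$ as $\|\xi\|_*\to\infty$, and $\Psi_u^*(w_1)=\Psi_u^*(w_2)$ whenever $w_1,w_2\in\partial\Psi_u(v)$; (ii) for all $R,M>0$ there is $K>0$ such that for all $u\in D$ with $\mathcal G(u)\le R$: $\Psi_u(v)\ge M\|v\|$ if $\|v\|\ge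 K$, and $\Psi^*_u(\xi)\ge M\|\xi\|_*$ if $\|\xi\|_*\ge K$. Assume on $(\mathcal E,\mathrm F,\mathrm P)$: (E0) $\mathcal E_t$ is lower semicontinuous for every $t\in[0,T]$, $\mathcal E\ge C_0$ on $[0,T]\times D$ for some $C_0>0$, and $\mathrm{graph}(\mathrm F)$ is a Borel subset of $[0,T]\times V\times V^*$; (E1) for every $t\in[0,T]$ the sublevels of $\mathcal E_t$ are compact; (E2) if $t\in[0,T]$, $u_o\in D$, $\tau>0$ and $\bar u$ minimizes $u\mapsto\mathcal E_t(u)+\tau\Psi_{u_o}((u-u_o)/\tau)$ over $V$, then there is $\xi\in \mathrm F_t(\bar u)$ with $-\xi\in\partial\Psi_{u_o}((\bar u-u_o)/\tau)$; (E3) there is $C_1>0$ with $|\mathcal E_t(u)-\mathcal E_s(u)|\le C_1\mathcal E_t(u)|t-s|$ for all $u\in D$, $t,s\in[0,T]$; (E4) $\mathrm P$ is Borel and there is $C_2>0$ such that for all $(t,u,\xi)\in\mathrm{graph}(\mathrm F)$, $\mathrm P_t(u,\xi)\le C_2\,\mathcal G(u)$ and, if $t<T$, $\liminf_{h\downarrow0}\frac{\mathcal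 E_{t+h}(u)-\mathcal E_t(u)}h\le \mathrm P_t(u,\xi)$; (E5) for every $u\in \mathrm{AC}([0,T];V)$ and $\xi\in L^1(0,T;V^*)$ with $\sup_{t\in(0,T)}|\mathcal E_t(u(t))|<\infty$, $\xi(t)\in \mathrm F_t(u(t))$ for a.a. $t\in(0,T)$, $\int_0^T\Psi_{u(t)}(u'(t))\,dt<\infty$ and $\int_0^T\Psi^*_{u(t)}(-\xi(t))\,dt<\infty$ (the integrands being measurable), the map $t\mapsto\mathcal E_t(u(t))$ is absolutely continuous on $(0,T)$ and $\frac{d}{dt}\mathcal E_t(u(t))\ge\langle\xi(t),u'(t)\rangle+\mathrm P_t(u(t),\xi(t))$ for a.a. $t\in(0,T)$; (E6) for every $t\in[0,T]$, if $\xi_n\in \mathrm F_t(u_n)$, $u_n\to u$ in $V$, $\xi_n\rightharpoonup\xi$ weakly in $V^*$, $\mathrm P_t(u_n,\xi_n)\to p$ and $\mathcal E_t(u_n)\to e$ in $\mathbb R$, then $\xi\in \mathrm F_t(u)$, $p\le \mathrm P_t(u,\xi)$ and $e=\mathcal E_t(u)$. Let $u\in\mathrm{AC}([0,T];V)$ satisfy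 $\mathrm F_t(u(t))\neq\emptyset$ for a.a. $t\in(0,T)$ and $\sup_{t\in(0,T)}\mathcal E_t(u(t))<+\infty$. Let $\{\mu_t\}_{t\in(0,T)}$ be a Young measure in $V\times V^*\times\mathbb R$, i.e. a family of Borel probability measures such that $t\mapsto\mu_t(B)$ is Lebesgue measurable for every Borel set $B$, and suppose that $$\int_0^T\!\int_{V\times V^*\times\mathbb R}\big(\Psi_{u(t)}(v)+\Psi^*_{u(t)}(-\zeta)\big)\,d\mu_t(v,\zeta,p)\,dt<+\infty$$ (where $(t,v,\zeta)\mapsto\Psi_{u(t)}(v)+\Psi^*_{u(t)}(-\zeta)$ is measurable with respect to the product of the Lebesgue $\sigma$-algebra of $(0,T)$ and the Borel $\sigma$-algebra of $V\times V^*$, possibly after removing a null set of times), that $u'(t)=\int v\,d\mu_t(v,\zeta,p)$ for a.a. $t\in(0,T)$, and that for a.a. $t\in(0,T)$ every $(v,\xi,p)\in\mathrm{supp}(\mu_t)$ satisfies $\xi\in \mathrm F_t(u(t))$ and $p\le \mathrm P_t(u(t),\xi)$. Then $t\mapsto\mathcal E_t(u(t))$ is absolutely continuous on $(0,T)$ (hence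 differentiable a.e.), and for a.a. $t\in(0,T)$ $$\frac{d}{dt}\mathcal E_t(u(t))\;\ge\;\int_{V\times V^*\times\mathbb R}\big(\langle u'(t),\zeta\rangle+p\big)\,d\mu_t(v,\zeta,p),$$ where the positive part of the integrand has finite integral, so that the right-hand side is well defined in $[-\infty,+\infty)$. -/

import Mathlib

open Set Filter Topology MeasureTheory

noncomputable section

/-- Reflexivity: the canonical embedding `V → V**` is onto. -/
def IsReflexiveSpace (V : Type*) [NormedAddCommGroup V] [NormedSpace ℝ V] : Prop :=
  Function.Surjective (NormedSpace.inclusionInDoubleDual ℝ V)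

/-- The Fenchel–Moreau conjugate `Ψ*(ξ) = sup_v (⟨ξ, v⟩ - Ψ(v))`, with values in `[-∞, +∞]`. -/
def fenchelConj {V : Type*} [NormedAddCommGroup V] [NormedSpace ℝ V]
    (Ψ : V → ℝ) (ξ : StrongDual ℝ V) : EReal :=
  ⨆ v : V, ((ξ v - Ψ v : ℝ) : EReal)

/-- The subdifferential of convex analysis. -/
def convexSubdiff {V : Type*} [NormedAddCommGroup V] [NormedSpace ℝ V]
    (Ψ : V → ℝ) (v : V) : Set (StrongDual ℝ V) :=
  {w | ∀ z, Ψ v + w (z - v) ≤ Ψ z}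

/-- Admissible dissipation potentials `Ψ : V → [0, +∞)`. -/
structure IsAdmissiblePotential {V : Type*} [NormedAddCommGroup V] [NormedSpace ℝ V]
    (Ψ : V → ℝ) : Prop where
  nonneg : ∀ v, 0 ≤ Ψ v
  lsc : LowerSemicontinuous Ψ
  convex : ConvexOn ℝ univ Ψ
  zero : Ψ 0 = 0
  superlinear : ∀ M : ℝ, ∃ K : ℝ, ∀ v : V, K ≤ ‖v‖ → M * ‖v‖ ≤ Ψ v
  conj_superlinear : ∀ M : ℝ, ∃ K : ℝ, ∀ ξ : StrongDual ℝ V, K ≤ ‖ξ‖ →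
    ((M * ‖ξ‖ : ℝ) : EReal) ≤ fenchelConj Ψ ξ
  conj_const : ∀ v, ∀ w₁ ∈ convexSubdiff Ψ v, ∀ w₂ ∈ convexSubdiff Ψ v,
    fenchelConj Ψ w₁ = fenchelConj Ψ w₂

/-- `sup_{t ∈ [0,T]} E_t(u)`. -/
def supEnergy {V : Type*} (T : ℝ) (E : ℝ → V → EReal) (u : V) : EReal :=
  ⨆ t ∈ Icc (0 : ℝ) T, E t u

/-- The (real) energy `t ↦ E_t(u(t))` along a curve on which the energy is finite. -/
def energyAlong {V : Type*} (E : ℝ → V → EReal) (u : ℝ → V) (t : ℝ) : ℝ :=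
  (E t (u t)).toReal

/-- The graph of a multivalued map `F : [0,T] × D ⇉ V*`, which is encoded as a map on `ℝ × V`
with empty values outside `[0,T] × D`. -/
def multiGraph {V : Type*} [NormedAddCommGroup V] [NormedSpace ℝ V]
    (F : ℝ → V → Set (StrongDual ℝ V)) : Set (ℝ × V × StrongDual ℝ V) :=
  {q | q.2.2 ∈ F q.1 q.2.1}

/-- Absolute continuity on the open interval `(a, b)`: the usual `ε`-`δ` condition on finite
families of disjoint intervals with end points in `(a, b)`. -/
def AbsContOnIoo (f : ℝ → ℝ) (a b : ℝ) : Prop :=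
  ∀ ε > (0 : ℝ), ∃ δ > (0 : ℝ), ∀ (n : ℕ) (I : ℕ → ℝ × ℝ),
    (∀ i < n, (I i).1 ∈ Ioo a b ∧ (I i).2 ∈ Ioo a b) →
    (Finset.range n : Set ℕ).PairwiseDisjoint (fun i => uIoc (I i).1 (I i).2) →
    ∑ i ∈ Finset.range n, dist (I i).1 (I i).2 < δ →
    ∑ i ∈ Finset.range n, dist (f (I i).1) (f (I i).2) < ε

/-- A (Lebesgue) measurable `[0, +∞]`-valued function with finite integral over `(0, T)`. -/
def HasFiniteTimeIntegral (T : ℝ) (f : ℝ → ENNReal) : Prop :=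
  AEMeasurable f (volume.restrict (Ioo 0 T)) ∧ ∫⁻ t in Ioo 0 T, f t < ⊤

/-- The integral in the extended sense, `∫ f⁺ - ∫ f⁻ ∈ [-∞, +∞]`; it is meaningful as soon as one
of the two terms is finite. -/
def extIntegral {α : Type*} [MeasurableSpace α] (μ : Measure α) (f : α → ℝ) : EReal :=
  ((∫⁻ x, ENNReal.ofReal (f x) ∂μ : ENNReal) : EReal)
    - ((∫⁻ x, ENNReal.ofReal (-f x) ∂μ : ENNReal) : EReal)

/-- The family `(Ψ_u)_{u ∈ D}` consists of admissible dissipation potentials, and `Ψ_u`, `Ψ_u*`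
have superlinear growth, uniformly on the sublevels of `sup_t E_t`. -/
structure DissipationAssumptions {V : Type*} [NormedAddCommGroup V] [NormedSpace ℝ V]
    (T : ℝ) (D : Set V) (E : ℝ → V → EReal) (Ψ : V → V → ℝ) : Prop where
  admissible : ∀ u ∈ D, IsAdmissiblePotential (Ψ u)
  superlinear : ∀ R > (0 : ℝ), ∀ M > (0 : ℝ), ∃ K > (0 : ℝ), ∀ u ∈ D, supEnergy T E u ≤ (R : EReal) →
    ∀ v : V, K ≤ ‖v‖ → M * ‖v‖ ≤ Ψ u v
  conj_superlinear : ∀ R > (0 : ℝ), ∀ M > (0 : ℝ), ∃ K > (0 : ℝ), ∀ u ∈ D,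
    supEnergy T E u ≤ (R : EReal) → ∀ ξ : StrongDual ℝ V, K ≤ ‖ξ‖ →
      ((M * ‖ξ‖ : ℝ) : EReal) ≤ fenchelConj (Ψ u) ξ

/-- The chain-rule inequality of `E` with respect to the triple `(Ψ, F, P)`. Since the energy is
bounded below by a positive constant, boundedness along the curve is boundedness from above. -/
def ChainRuleInequality {V : Type*} [NormedAddCommGroup V] [NormedSpace ℝ V]
    (T : ℝ) (E : ℝ → V → EReal) (Ψ : V → V → ℝ)
    (F : ℝ → V → Set (StrongDual ℝ V)) (P : ℝ → V → StrongDual ℝ V → ℝ) : Prop :=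
  ∀ (u : ℝ → V) (ξ : ℝ → StrongDual ℝ V),
    AbsolutelyContinuousOnInterval u 0 T →
    Integrable ξ (volume.restrict (Ioo 0 T)) →
    (∃ S : ℝ, ∀ t ∈ Ioo 0 T, E t (u t) ≤ (S : EReal)) →
    (∀ᵐ t ∂(volume.restrict (Ioo 0 T)), ξ t ∈ F t (u t)) →
    HasFiniteTimeIntegral T (fun t => ENNReal.ofReal (Ψ (u t) (deriv u t))) →
    HasFiniteTimeIntegral T (fun t => (fenchelConj (Ψ (u t)) (-ξ t)).toENNReal) →
    AbsContOnIoo (energyAlong E u) 0 T ∧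
      ∀ᵐ t ∂(volume.restrict (Ioo 0 T)),
        ξ t (deriv u t) + P t (u t) (ξ t) ≤ deriv (energyAlong E u) t

/-- The assumptions on the energy `E : [0,T] × V → (-∞, +∞]` with domain `[0,T] × D`, its
subdifferential `F : [0,T] × D ⇉ V*` and its generalized time derivative `P : graph F → ℝ`.
Values of `E` at times outside `[0,T]`, and of `P` outside the graph of `F`, play no role. -/
structure EnergyAssumptions {V : Type*} [NormedAddCommGroup V] [NormedSpace ℝ V]
    [MeasurableSpace V]
    (T : ℝ) (D : Set V) (E : ℝ → V → EReal) (Ψ : V → V → ℝ)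
    (F : ℝ → V → Set (StrongDual ℝ V)) (P : ℝ → V → StrongDual ℝ V → ℝ) : Prop where
  dom_energy : ∀ t ∈ Icc 0 T, {u | E t u < ⊤} = D
  dom_subdiff : ∀ t u, (F t u).Nonempty → t ∈ Icc 0 T ∧ u ∈ D
  lsc : ∀ t ∈ Icc 0 T, LowerSemicontinuous (E t)
  bounded_below : ∃ C₀ > (0 : ℝ), ∀ t ∈ Icc 0 T, ∀ u ∈ D, (C₀ : EReal) ≤ E t u
  graph_borel : MeasurableSet (multiGraph F)
  coercive : ∀ t ∈ Icc 0 T, ∀ R : ℝ, IsCompact {u | E t u ≤ (R : EReal)}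
  sum_rule : ∀ t ∈ Icc 0 T, ∀ u₀ ∈ D, ∀ τ > (0 : ℝ), ∀ w : V,
    (∀ z : V, E t w + ((τ * Ψ u₀ (τ⁻¹ • (w - u₀)) : ℝ) : EReal)
      ≤ E t z + ((τ * Ψ u₀ (τ⁻¹ • (z - u₀)) : ℝ) : EReal)) →
    ∃ ξ ∈ F t w, -ξ ∈ convexSubdiff (Ψ u₀) (τ⁻¹ • (w - u₀))
  lipschitz : ∃ C₁ > (0 : ℝ), ∀ u ∈ D, ∀ t ∈ Icc 0 T, ∀ s ∈ Icc 0 T,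
    |(E t u).toReal - (E s u).toReal| ≤ C₁ * (E t u).toReal * |t - s|
  time_deriv_borel : Measurable
    (fun q : multiGraph F => P q.1.1 q.1.2.1 q.1.2.2)
  time_deriv_lower : ∀ t u, ∀ ξ ∈ F t u, t < T →
    liminf (fun h : ℝ => ((((E (t + h) u).toReal - (E t u).toReal) / h : ℝ) : EReal)) (𝓝[>] 0)
      ≤ (P t u ξ : EReal)
  time_deriv_upper : ∃ C₂ > (0 : ℝ), ∀ t u, ∀ ξ ∈ F t u,
    (P t u ξ : EReal) ≤ (C₂ : EReal) * supEnergy T E u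
  chain_rule : ChainRuleInequality T E Ψ F P
  -- strong convergence of `u n`, weak convergence in `V*` of `ξ n`
  weakly_closed : ∀ t ∈ Icc 0 T, ∀ (u : ℕ → V) (ξ : ℕ → StrongDual ℝ V)
    (u' : V) (ξ' : StrongDual ℝ V) (p' e' : ℝ),
    (∀ n, ξ n ∈ F t (u n)) →
    Tendsto u atTop (𝓝 u') →
    (∀ φ : StrongDual ℝ (StrongDual ℝ V), Tendsto (fun n => φ (ξ n)) atTop (𝓝 (φ ξ'))) →
    Tendsto (fun n => P t (u n) (ξ n)) atTop (𝓝 p') →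
    Tendsto (fun n => E t (u n)) atTop (𝓝 (e' : EReal)) →
    ξ' ∈ F t u' ∧ p' ≤ P t u' ξ' ∧ (e' : EReal) = E t u'

/-- A Young measure on `(0,T)`: Borel probability measures `μ t`, `t ∈ (0,T)`, such that
`t ↦ μ t B` is Lebesgue measurable on `(0,T)` for every Borel set `B`. -/
structure IsYoungMeasure {W : Type*} [MeasurableSpace W] (T : ℝ) (μ : ℝ → Measure W) : Prop where
  prob : ∀ t ∈ Ioo 0 T, IsProbabilityMeasure (μ t)
  meas : ∀ B : Set W, MeasurableSet B → AEMeasurable (fun t => μ t B) (volume.restrict (Ioo 0 T))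

/-- The integrand `(t, (v, ζ, p)) ↦ Ψ_{u(t)}(v) + Ψ*_{u(t)}(-ζ) ∈ [0, +∞]`. -/
def dissipationIntegrand {V : Type*} [NormedAddCommGroup V] [NormedSpace ℝ V]
    (Ψ : V → V → ℝ) (u : ℝ → V) (t : ℝ) (w : V × StrongDual ℝ V × ℝ) : ENNReal :=
  ENNReal.ofReal (Ψ (u t) w.1) + (fenchelConj (Ψ (u t)) (-w.2.1)).toENNReal

end

/-!
A Young measure `(μ t)` is the family of laws of a random curve `t ↦ f t s`, with `s` uniform on
`[0, 1]`. By Fubini, for almost every `s` this curve is an admissible selection `(v, ξ, p)`, with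
`ξ ∈ F t (u t)`, `p ≤ P t (u t) ξ` and finite dissipation, so that the chain rule along single
curves gives `⟨ξ, u'⟩ + p ≤ d/dt E t (u t)` for a.e. `t`. By Fubini again this inequality holds, for
a.e. `t`, for `μ t`-almost every `(v, ξ, p)`, and it remains to integrate it. The velocity `u'` has
finite dissipation by Jensen's inequality, since it is the barycentre of `μ t`.
-/

section FunctionalAnalysis

variable {𝕜 X : Type*} [RCLike 𝕜] [NormedAddCommGroup X] [NormedSpace 𝕜 X]

theorem dense_of_forall_strongDual_eq_zero {S : Submodule 𝕜 X}
    (hS : ∀ g : StrongDual 𝕜 X, (∀ x ∈ S, g x = 0) → g = 0) : Dense (S : Set X) := by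
  rw [Submodule.dense_iff_topologicalClosure_eq_top, Submodule.eq_top_iff']
  intro x
  have := S.isClosed_topologicalClosure
  rw [← Submodule.Quotient.mk_eq_zero]
  refine SeparatingDual.eq_zero_of_forall_dual_eq_zero (R := 𝕜) fun f => ?_
  have hf : f.comp S.topologicalClosure.mkQL = 0 := hS _ fun y hy => by
    have hy0 := (Submodule.Quotient.mk_eq_zero _).2 (S.le_topologicalClosure hy)
    simp [hy0]
  exact DFunLike.congr_fun hf x

theorem separableSpace_of_separableSpace_strongDual
    [TopologicalSpace.SeparableSpace (StrongDual 𝕜 X)] : TopologicalSpace.SeparableSpace X := by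
  let f := TopologicalSpace.denseSeq (StrongDual 𝕜 X)
  have half_norming : ∀ n, ∃ x : X, ‖x‖ ≤ 1 ∧ ‖f n‖ / 2 ≤ ‖f n x‖ := fun n => by
    rcases eq_or_ne (f n) 0 with h | h
    · exact ⟨0, by simp [h]⟩
    · obtain ⟨x, hx, hfx⟩ := (f n).exists_lt_apply_of_lt_opNorm
        (half_lt_self (norm_pos_iff.2 h))
      exact ⟨x, hx.le, hfx.le⟩
  choose x hx hfx using half_norming
  have hdense : Dense (Submodule.span 𝕜 (range x) : Set X) := by
    refine dense_of_forall_strongDual_eq_zero fun g hg => norm_le_zero_iff.1 ?_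
    have norm_le : ∀ n, ‖g‖ ≤ 3 * dist g (f n) := fun n => by
      have hgx : g (x n) = 0 := hg _ (Submodule.subset_span (mem_range_self n))
      have hfgx : ‖f n (x n)‖ ≤ ‖g - f n‖ := by
        simpa [hgx] using (g - f n).unit_le_opNorm _ (hx n)
      have htri : ‖g‖ ≤ ‖g - f n‖ + ‖f n‖ := norm_le_norm_sub_add _ _
      rw [dist_eq_norm]
      linarith [hfx n]
    refine le_of_forall_pos_le_add fun ε hε => ?_
    obtain ⟨n, hn⟩ := (TopologicalSpace.denseRange_denseSeq (StrongDual 𝕜 X)).exists_dist_lt g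
      (by positivity : 0 < ε / 3)
    linarith [norm_le n, show dist g (f n) < ε / 3 from hn]
  have hsep := (countable_range x).isSeparable.span (R := 𝕜) |>.closure
  rw [hdense.closure_eq] at hsep
  exact TopologicalSpace.isSeparable_univ_iff.1 hsep

theorem IsReflexiveSpace.secondCountableTopology_strongDual {V : Type*} [NormedAddCommGroup V]
    [NormedSpace ℝ V] [TopologicalSpace.SeparableSpace V] (hV : IsReflexiveSpace V) :
    SecondCountableTopology (StrongDual ℝ V) := by
  have : TopologicalSpace.SeparableSpace (StrongDual ℝ (StrongDual ℝ V)) :=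
    hV.denseRange.separableSpace (NormedSpace.inclusionInDoubleDual ℝ V).continuous
  have := separableSpace_of_separableSpace_strongDual (𝕜 := ℝ) (X := StrongDual ℝ V)
  exact UniformSpace.secondCountable_of_separable _

end FunctionalAnalysis

section Integration

variable {α : Type*} [MeasurableSpace α] {m : Measure α}

theorem integrable_of_enorm_le_const_add {X : Type*} [NormedAddCommGroup X] [IsFiniteMeasure m]
    {f : α → X} {c : ENNReal} {g : α → ENNReal} (hf : AEStronglyMeasurable f m) (hc : c ≠ ⊤)
    (hfg : ∀ᵐ x ∂m, ‖f x‖ₑ ≤ c + g x) (hg : ∫⁻ x, g x ∂m < ⊤) : Integrable f m := by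
  refine ⟨hf, (lintegral_mono_ae hfg).trans_lt ?_⟩
  rw [lintegral_add_left measurable_const]
  exact ENNReal.add_lt_top.2 ⟨lintegral_const_lt_top hc, hg⟩

theorem ofReal_integral_le_lintegral_ofReal (f : α → ℝ) :
    ENNReal.ofReal (∫ x, f x ∂m) ≤ ∫⁻ x, ENNReal.ofReal (f x) ∂m := by
  by_cases hf : Integrable f m
  · rw [integral_eq_lintegral_pos_part_sub_lintegral_neg_part hf]
    exact (ENNReal.ofReal_le_ofReal (sub_le_self _ ENNReal.toReal_nonneg)).trans
      ENNReal.ofReal_toReal_le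
  · simp [integral_undef hf]

theorem ofReal_map_integral_le_lintegral_ofReal {X : Type*} [NormedAddCommGroup X]
    [NormedSpace ℝ X] [CompleteSpace X] [IsProbabilityMeasure m] {φ : X → ℝ} {f : α → X}
    (hφ : ConvexOn ℝ univ φ) (hlsc : LowerSemicontinuous φ) (hf : Integrable f m) :
    ENNReal.ofReal (φ (∫ x, f x ∂m)) ≤ ∫⁻ x, ENNReal.ofReal (φ (f x)) ∂m := by
  refine le_of_forall_lt_imp_le_of_dense fun b hb => ?_
  have hb_top : b ≠ ⊤ := (hb.trans ENNReal.ofReal_lt_top).ne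
  rw [ENNReal.lt_ofReal_iff_toReal_lt hb_top] at hb
  obtain ⟨l, c, hle, heq⟩ := hφ.exists_affine_le_of_lt (𝕜 := ℝ) (mem_univ _) hb isClosed_univ
    (hlsc.lowerSemicontinuousOn _)
  have minorant_le : ∀ y, l y + c ≤ φ y := fun y => by simpa using hle ⟨y, mem_univ y⟩
  have integral_minorant : ∫ x, (l (f x) + c) ∂m = b.toReal := by
    rw [integral_add (l.integrable_comp hf) (integrable_const c), l.integral_comp_comm hf, ← heq]
    simp
  calc b = ENNReal.ofReal (∫ x, (l (f x) + c) ∂m) := by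
        rw [integral_minorant, ENNReal.ofReal_toReal hb_top]
    _ ≤ ∫⁻ x, ENNReal.ofReal (l (f x) + c) ∂m := ofReal_integral_le_lintegral_ofReal _
    _ ≤ ∫⁻ x, ENNReal.ofReal (φ (f x)) ∂m :=
        lintegral_mono fun x => ENNReal.ofReal_le_ofReal (minorant_le _)

theorem lintegral_ofReal_lt_top_of_ae_le [IsFiniteMeasure m] {f : α → ℝ} {c : ℝ}
    (hfc : ∀ᵐ x ∂m, f x ≤ c) : ∫⁻ x, ENNReal.ofReal (f x) ∂m < ⊤ :=
  (lintegral_mono_ae (hfc.mono fun _ hx => ENNReal.ofReal_le_ofReal hx)).trans_lt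
    (lintegral_const_lt_top ENNReal.ofReal_ne_top)

theorem extIntegral_mono_ae {f g : α → ℝ} (hfg : ∀ᵐ x ∂m, f x ≤ g x) :
    extIntegral m f ≤ extIntegral m g := by
  refine EReal.sub_le_sub (EReal.coe_ennreal_le_coe_ennreal_iff.2 (lintegral_mono_ae ?_))
    (EReal.coe_ennreal_le_coe_ennreal_iff.2 (lintegral_mono_ae ?_))
  · exact hfg.mono fun _ hx => ENNReal.ofReal_le_ofReal hx
  · exact hfg.mono fun _ hx => ENNReal.ofReal_le_ofReal (neg_le_neg hx)

theorem extIntegral_const [IsProbabilityMeasure m] (c : ℝ) :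
    extIntegral m (fun _ => c) = (c : EReal) := by
  simp only [extIntegral, lintegral_const, measure_univ, mul_one, EReal.coe_ennreal_ofReal]
  rw [← EReal.coe_sub, max_zero_sub_max_neg_zero_eq_self]

end Integration

section AbsolutelyContinuous

variable {f : ℝ → ℝ} {a b : ℝ}

theorem AbsContOnIoo.absolutelyContinuousOnInterval (hf : AbsContOnIoo f a b) {p q : ℝ}
    (hp : p ∈ Ioo a b) (hq : q ∈ Ioo a b) : AbsolutelyContinuousOnInterval f p q := by
  rw [absolutelyContinuousOnInterval_iff]
  intro ε hε
  obtain ⟨δ, hδ, h⟩ := hf ε hε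
  have hpq : uIcc p q ⊆ Ioo a b := ordConnected_Ioo.uIcc_subset hp hq
  refine ⟨δ, hδ, fun I hI => h I.1 I.2 (fun i hi => ?_) hI.2⟩
  exact (hI.1 i (Finset.mem_range.2 hi)).imp (fun h => hpq h) fun h => hpq h

theorem AbsContOnIoo.locallyBoundedVariationOn (hf : AbsContOnIoo f a b) :
    LocallyBoundedVariationOn f (Ioo a b) := fun _ _ hp hq =>
  (hf.absolutelyContinuousOnInterval hp hq).boundedVariationOn.mono
    (inter_subset_right.trans Icc_subset_uIcc)

theorem AbsContOnIoo.ae_differentiableAt (hf : AbsContOnIoo f a b) :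
    ∀ᵐ x ∂(volume.restrict (Ioo a b)), DifferentiableAt ℝ f x := by
  rw [ae_restrict_iff' measurableSet_Ioo]
  filter_upwards [hf.locallyBoundedVariationOn.ae_differentiableWithinAt_of_mem] with x hx hx_mem
  exact (hx hx_mem).differentiableAt (Ioo_mem_nhds hx_mem.1 hx_mem.2)

end AbsolutelyContinuous

section YoungMeasures

variable {α W : Type*} [MeasurableSpace α]

theorem exists_countable_isPiSystem_generateFrom_eq (W : Type*) [mW : MeasurableSpace W]
    [MeasurableSpace.CountablyGenerated W] :
    ∃ S : Set (Set W), S.Countable ∧ IsPiSystem S ∧ MeasurableSpace.generateFrom S = mW := by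
  let s := MeasurableSpace.natGeneratingSequence W
  refine ⟨piiUnionInter (fun n => {s n}) univ, ?_, ?_, ?_⟩
  · rw [piiUnionInter_singleton_left]
    refine (countable_range fun t : Finset ℕ => ⋂ n ∈ t, s n).mono ?_
    rintro _ ⟨t, -, rfl⟩
    exact mem_range_self t
  · exact isPiSystem_piiUnionInter _ (fun _ => IsPiSystem.singleton _) _
  · rw [generateFrom_piiUnionInter_singleton_left]
    simp only [mem_univ, true_and]
    rw [← MeasurableSpace.generateFrom_natGeneratingSequence W]
    rfl

theorem exists_isMarkovKernel_ae_eq [MeasurableSpace W] [MeasurableSpace.CountablyGenerated W]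
    [Nonempty W] {ν : Measure α} {μ : α → Measure W}
    (hprob : ∀ᵐ a ∂ν, IsProbabilityMeasure (μ a))
    (hmeas : ∀ B, MeasurableSet B → AEMeasurable (fun a => μ a B) ν) :
    ∃ κ : ProbabilityTheory.Kernel α W, ProbabilityTheory.IsMarkovKernel κ ∧
      ∀ᵐ a ∂ν, κ a = μ a := by
  classical
  obtain ⟨S, hS_countable, hS_pi, hS_gen⟩ := exists_countable_isPiSystem_generateFrom_eq W
  have := hS_countable.to_subtype
  have hS_meas : ∀ B : S, AEMeasurable (fun a => μ a B) ν := fun B =>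
    hmeas B (hS_gen ▸ MeasurableSpace.measurableSet_generateFrom B.2)
  let good : Set α := aeSeqSet hS_meas fun a _ => IsProbabilityMeasure (μ a)
  have hgood : MeasurableSet good := aeSeq.aeSeqSet_measurableSet
  let κ : α → Measure W :=
    fun a => if a ∈ good then μ a else Measure.dirac (Classical.arbitrary W)
  have hκ_prob : ∀ a, IsProbabilityMeasure (κ a) := fun a => by
    by_cases ha : a ∈ good
    · simpa only [κ, if_pos ha] using aeSeq.prop_of_mem_aeSeqSet hS_meas ha
    · simpa only [κ, if_neg ha] using Measure.dirac.isProbabilityMeasure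
  have hκ_meas : Measurable κ := by
    refine .measure_of_isPiSystem_of_isProbabilityMeasure hS_gen.symm hS_pi fun B hB => ?_
    have hκB : (fun a => κ a B) = fun a => if a ∈ good then (hS_meas ⟨B, hB⟩).mk _ a
        else Measure.dirac (Classical.arbitrary W) B := by
      funext a
      by_cases ha : a ∈ good
      · simp only [κ, if_pos ha, aeSeq.mk_eq_fun_of_mem_aeSeqSet hS_meas ha ⟨B, hB⟩]
      · simp only [κ, if_neg ha]
    rw [hκB]
    exact (hS_meas ⟨B, hB⟩).measurable_mk.ite hgood measurable_const
  refine ⟨⟨κ, hκ_meas⟩, ⟨hκ_prob⟩, ?_⟩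
  have hgood_null : ν goodᶜ = 0 :=
    aeSeq.measure_compl_aeSeqSet_eq_zero (p := fun a _ => IsProbabilityMeasure (μ a)) hS_meas hprob
  filter_upwards [measure_eq_zero_iff_ae_notMem.1 hgood_null] with a ha
  exact if_pos (notMem_compl_iff.1 ha)

/-- `G` coincides, for `ν`-almost every value of its first argument, with a function that is
measurable on the product space. For sets, take `β = Prop`. -/
def AEJointlyMeasurable {β : Type*} [MeasurableSpace W] [MeasurableSpace β] (G : α → W → β)
    (ν : Measure α) : Prop :=
  ∃ g : α × W → β, Measurable g ∧ ∀ᵐ a ∂ν, ∀ w, G a w = g (a, w)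

theorem AEJointlyMeasurable.aemeasurable_comp {β : Type*} [MeasurableSpace W] [MeasurableSpace β]
    {G : α → W → β} {ν : Measure α} (hG : AEJointlyMeasurable G ν) {w : α → W}
    (hw : Measurable w) : AEMeasurable (fun a => G a (w a)) ν := by
  obtain ⟨g, hg, hGg⟩ := hG
  exact ⟨fun a => g (a, w a), by fun_prop, hGg.mono fun a ha => ha (w a)⟩

/-- The family `μ` is represented by the random curve `f`: the curves `f · s` depend on a random
parameter `s` of law `ρ`, and `μ a` is the law of `s ↦ f a s`, for `ν`-almost every `a`. -/
structure IsRandomCurve {Ω : Type*} [MeasurableSpace Ω] [MeasurableSpace W] (f : α → Ω → W)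
    (ρ : Measure Ω) (μ : α → Measure W) (ν : Measure α) : Prop where
  measurable_uncurry : Measurable (Function.uncurry f)
  map_ae_eq : ∀ᵐ a ∂ν, ρ.map (f a) = μ a

theorem exists_isRandomCurve [MeasurableSpace W] [StandardBorelSpace W] [Nonempty W]
    {ν : Measure α} {μ : α → Measure W} (hprob : ∀ᵐ a ∂ν, IsProbabilityMeasure (μ a))
    (hmeas : ∀ B, MeasurableSet B → AEMeasurable (fun a => μ a B) ν) :
    ∃ f : α → unitInterval → W, IsRandomCurve f volume μ ν := by
  obtain ⟨κ, hκ, hκμ⟩ := exists_isMarkovKernel_ae_eq hprob hmeas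
  obtain ⟨f, hf, hfκ⟩ := κ.exists_measurable_map_eq_unitInterval
  exact ⟨f, hf, hκμ.mono fun a ha => (hfκ a).trans ha⟩

namespace IsRandomCurve

variable {Ω : Type*} [MeasurableSpace Ω] [MeasurableSpace W] {f : α → Ω → W} {ρ : Measure Ω}
  {μ : α → Measure W} {ν : Measure α} [SFinite ν] [SFinite ρ]

theorem ae_ae_iff (hf : IsRandomCurve f ρ μ ν) {p : α → W → Prop}
    (hp : AEJointlyMeasurable p ν) :
    (∀ᵐ a ∂ν, ∀ᵐ w ∂(μ a), p a w) ↔ ∀ᵐ s ∂ρ, ∀ᵐ a ∂ν, p a (f a s) := by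
  obtain ⟨g, hg, hpg⟩ := hp
  have hg_f : Measurable fun x : α × Ω => g (x.1, f x.1 x.2) :=
    hg.comp (measurable_fst.prodMk hf.measurable_uncurry)
  have law : ∀ᵐ a ∂ν, (∀ᵐ w ∂(μ a), p a w) ↔ ∀ᵐ s ∂ρ, g (a, f a s) := by
    filter_upwards [hpg, hf.map_ae_eq] with a ha_p ha_map
    simp only [ha_p]
    rw [← ha_map, ae_map_iff hf.measurable_uncurry.of_uncurry_left.aemeasurable
      (measurableSet_setOfPred.2 (by fun_prop))]
  rw [eventually_congr law, Measure.ae_ae_comm (measurableSet_setOfPred.2 hg_f)]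
  refine eventually_congr (ae_of_all _ fun s => eventually_congr ?_)
  filter_upwards [hpg] with a ha
  rw [ha]

theorem ae_lintegral_lt_top (hf : IsRandomCurve f ρ μ ν) {G : α → W → ENNReal}
    (hG : AEJointlyMeasurable G ν) (hfin : ∫⁻ a, ∫⁻ w, G a w ∂(μ a) ∂ν < ⊤) :
    ∀ᵐ s ∂ρ, ∫⁻ a, G a (f a s) ∂ν < ⊤ := by
  obtain ⟨g, hg, hGg⟩ := hG
  have hg_f : Measurable fun x : α × Ω => g (x.1, f x.1 x.2) :=
    hg.comp (measurable_fst.prodMk hf.measurable_uncurry)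
  have law : ∀ᵐ a ∂ν, ∫⁻ w, G a w ∂(μ a) = ∫⁻ s, g (a, f a s) ∂ρ := by
    filter_upwards [hGg, hf.map_ae_eq] with a ha_G ha_map
    rw [lintegral_congr ha_G, ← ha_map, lintegral_map (f := fun w => g (a, w)) (by fun_prop)
      hf.measurable_uncurry.of_uncurry_left]
  rw [lintegral_congr_ae law, lintegral_lintegral_swap hg_f.aemeasurable] at hfin
  filter_upwards [ae_lt_top hg_f.lintegral_prod_left' hfin.ne] with s hs
  rwa [lintegral_congr_ae (hGg.mono fun a ha => ha (f a s))]

end IsRandomCurve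

end YoungMeasures

section Dissipation

variable {V : Type*} [NormedAddCommGroup V] [NormedSpace ℝ V]

/-- Dissipation potentials `Ψ` such that both `Ψ` and `Ψ*` grow at least linearly, with slope one
up to the constant `K`. The uniform superlinear growth of a family `(Ψ_u)` provides such a `K` on
each sublevel of the energy. -/
structure IsCoercivePotential (Ψ : V → ℝ) (K : ℝ) : Prop where
  nonneg : ∀ v, 0 ≤ Ψ v
  lsc : LowerSemicontinuous Ψ
  convex : ConvexOn ℝ univ Ψ
  zero : Ψ 0 = 0
  norm_le : ∀ v, ‖v‖ ≤ K + Ψ v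
  norm_le_conj : ∀ ξ : StrongDual ℝ V, (‖ξ‖ : EReal) ≤ K + fenchelConj Ψ ξ

namespace IsCoercivePotential

variable {Ψ : V → ℝ} {K : ℝ}

theorem fenchelConj_zero (hΨ : IsCoercivePotential Ψ K) : fenchelConj Ψ 0 = 0 := by
  refine le_antisymm (iSup_le fun v => ?_) (le_iSup_of_le 0 ?_)
  · have hv : (0 : StrongDual ℝ V) v - Ψ v ≤ 0 := by simpa using hΨ.nonneg v
    exact_mod_cast hv
  · simp [hΨ.zero]

theorem enorm_le (hΨ : IsCoercivePotential Ψ K) (v : V) :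
    ‖v‖ₑ ≤ ENNReal.ofReal K + ENNReal.ofReal (Ψ v) := by
  rw [← ofReal_norm]
  exact (ENNReal.ofReal_le_ofReal (hΨ.norm_le v)).trans ENNReal.ofReal_add_le

theorem enorm_le_conj (hΨ : IsCoercivePotential Ψ K) (ξ : StrongDual ℝ V) :
    ‖ξ‖ₑ ≤ ENNReal.ofReal K + (fenchelConj Ψ ξ).toENNReal := by
  rw [← ofReal_norm, ← EReal.real_coe_toENNReal, ← EReal.real_coe_toENNReal]
  exact (EReal.toENNReal_le_toENNReal (hΨ.norm_le_conj ξ)).trans EReal.toENNReal_add_le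

theorem ofReal_map_integral_le [CompleteSpace V] {α : Type*} [MeasurableSpace α] {m : Measure α}
    [IsProbabilityMeasure m] (hΨ : IsCoercivePotential Ψ K) {f : α → V}
    (hf : AEStronglyMeasurable f m) :
    ENNReal.ofReal (Ψ (∫ x, f x ∂m)) ≤ ∫⁻ x, ENNReal.ofReal (Ψ (f x)) ∂m := by
  rcases eq_top_or_lt_top (∫⁻ x, ENNReal.ofReal (Ψ (f x)) ∂m) with htop | hfin
  · exact htop ▸ le_top
  · exact ofReal_map_integral_le_lintegral_ofReal hΨ.convex hΨ.lsc <|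
      integrable_of_enorm_le_const_add hf ENNReal.ofReal_ne_top
        (ae_of_all _ fun x => hΨ.enorm_le (f x)) hfin

end IsCoercivePotential

variable {Ψ : V → V → ℝ} {u : ℝ → V} {t : ℝ} {K : ℝ}

theorem dissipationIntegrand_velocity (hΨ : IsCoercivePotential (Ψ (u t)) K) (v : V) :
    dissipationIntegrand Ψ u t (v, 0, 0) = ENNReal.ofReal (Ψ (u t) v) := by
  simp [dissipationIntegrand, hΨ.fenchelConj_zero]

theorem dissipationIntegrand_force (hΨ : IsCoercivePotential (Ψ (u t)) K) (ζ : StrongDual ℝ V) :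
    dissipationIntegrand Ψ u t (0, ζ, 0) = (fenchelConj (Ψ (u t)) (-ζ)).toENNReal := by
  simp [dissipationIntegrand, hΨ.zero]

end Dissipation

section Energy

variable {V : Type*} [NormedAddCommGroup V] [NormedSpace ℝ V]
  {T : ℝ} {D : Set V} {E : ℝ → V → EReal} {Ψ : V → V → ℝ}
  {F : ℝ → V → Set (StrongDual ℝ V)} {P : ℝ → V → StrongDual ℝ V → ℝ}

namespace EnergyAssumptions

variable [MeasurableSpace V]

theorem coe_toReal_energy (hE : EnergyAssumptions T D E Ψ F P) {t : ℝ} (ht : t ∈ Icc 0 T) {x : V}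
    (hx : x ∈ D) : ((E t x).toReal : EReal) = E t x := by
  obtain ⟨C₀, -, hlow⟩ := hE.bounded_below
  rw [← hE.dom_energy t ht] at hx
  exact EReal.coe_toReal hx.ne
    ((EReal.bot_lt_coe C₀).trans_le (hlow t ht x (hE.dom_energy t ht ▸ hx))).ne'

theorem toReal_energy_nonneg (hE : EnergyAssumptions T D E Ψ F P) {t : ℝ} (ht : t ∈ Icc 0 T)
    {x : V} (hx : x ∈ D) : 0 ≤ (E t x).toReal := by
  obtain ⟨C₀, hC₀, hlow⟩ := hE.bounded_below
  exact EReal.toReal_nonneg ((EReal.coe_nonneg.2 hC₀.le).trans (hlow t ht x hx))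

theorem exists_supEnergy_le_mul (hE : EnergyAssumptions T D E Ψ F P) :
    ∃ C ≥ (0 : ℝ), ∀ t ∈ Icc 0 T, ∀ x ∈ D,
      supEnergy T E x ≤ ((C * (E t x).toReal : ℝ) : EReal) := by
  obtain ⟨C₁, hC₁, hlip⟩ := hE.lipschitz
  refine ⟨1 + C₁ * |T|, by positivity, fun t ht x hx => iSup₂_le fun s hs => ?_⟩
  have hts : |t - s| ≤ |T| :=
    (abs_sub_le_of_nonneg_of_le ht.1 ht.2 hs.1 hs.2).trans (le_abs_self T)
  have hE_nonneg := hE.toReal_energy_nonneg ht hx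
  have hE_sub := (abs_le.1 (hlip x hx t ht s hs)).1
  have hE_mul : C₁ * (E t x).toReal * |t - s| ≤ C₁ * (E t x).toReal * |T| := by gcongr
  rw [← hE.coe_toReal_energy hs hx, EReal.coe_le_coe_iff]
  linarith

theorem exists_supEnergy_le (hE : EnergyAssumptions T D E Ψ F P) {u : ℝ → V}
    (hbdd : ∃ S : ℝ, ∀ t ∈ Ioo 0 T, E t (u t) ≤ (S : EReal)) :
    ∃ R : ℝ, ∀ t ∈ Ioo 0 T, u t ∈ D ∧ supEnergy T E (u t) ≤ (R : EReal) := by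
  obtain ⟨S, hS⟩ := hbdd
  obtain ⟨C, hC, hsup⟩ := hE.exists_supEnergy_le_mul
  refine ⟨C * S, fun t ht => ?_⟩
  have htI := Ioo_subset_Icc_self ht
  have hD : u t ∈ D := hE.dom_energy t htI ▸ (hS t ht).trans_lt (EReal.coe_lt_top S)
  have hES : (E t (u t)).toReal ≤ S := by
    rw [← EReal.coe_le_coe_iff, hE.coe_toReal_energy htI hD]
    exact hS t ht
  exact ⟨hD, (hsup t htI _ hD).trans (EReal.coe_le_coe_iff.2 (by gcongr))⟩

end EnergyAssumptions

theorem DissipationAssumptions.exists_isCoercivePotential (hΨ : DissipationAssumptions T D E Ψ)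
    (R : ℝ) :
    ∃ K : ℝ, ∀ x ∈ D, supEnergy T E x ≤ (R : EReal) → IsCoercivePotential (Ψ x) K := by
  have hR_pos : 0 < max 1 R := by positivity
  obtain ⟨K₁, hK₁, hvel⟩ := hΨ.superlinear _ hR_pos 1 one_pos
  obtain ⟨K₂, -, hconj⟩ := hΨ.conj_superlinear _ hR_pos 1 one_pos
  refine ⟨max K₁ K₂, fun x hx hxR => ?_⟩
  have hxR' := hxR.trans (EReal.coe_le_coe_iff.2 (le_max_right 1 R))
  have h := hΨ.admissible x hx
  refine ⟨h.nonneg, h.lsc, h.convex, h.zero, fun v => ?_, fun ξ => ?_⟩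
  · rcases le_total K₁ ‖v‖ with hv | hv
    · linarith [hvel x hx hxR' v hv, le_max_left K₁ K₂]
    · linarith [h.nonneg v, le_max_left K₁ K₂]
  · have hconj_nonneg : 0 ≤ fenchelConj (Ψ x) ξ := le_iSup_of_le 0 (by simp [h.zero])
    rcases le_total K₂ ‖ξ‖ with hξ | hξ
    · have hK_nonneg : (0 : EReal) ≤ (max K₁ K₂ : ℝ) := EReal.coe_nonneg.2 (by positivity)
      exact le_add_of_nonneg_of_le hK_nonneg (by simpa using hconj x hx hxR' ξ hξ)
    · exact le_add_of_le_of_nonneg (EReal.coe_le_coe_iff.2 (hξ.trans (le_max_right _ _)))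
        hconj_nonneg

theorem exists_ae_isCoercivePotential [MeasurableSpace V] (hΨ : DissipationAssumptions T D E Ψ)
    (hE : EnergyAssumptions T D E Ψ F P) {u : ℝ → V}
    (hbdd : ∃ S : ℝ, ∀ t ∈ Ioo 0 T, E t (u t) ≤ (S : EReal)) :
    ∃ K : ℝ, ∀ᵐ t ∂(volume.restrict (Ioo 0 T)), IsCoercivePotential (Ψ (u t)) K := by
  obtain ⟨R, hR⟩ := hE.exists_supEnergy_le hbdd
  obtain ⟨K, hK⟩ := hΨ.exists_isCoercivePotential R
  exact ⟨K, (ae_restrict_mem measurableSet_Ioo).mono fun t ht => hK _ (hR t ht).1 (hR t ht).2⟩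

end Energy

section ChainRule

variable {V : Type*} [NormedAddCommGroup V] [NormedSpace ℝ V] [MeasurableSpace V]
  {T : ℝ} {E : ℝ → V → EReal} {Ψ : V → V → ℝ}
  {F : ℝ → V → Set (StrongDual ℝ V)} {P : ℝ → V → StrongDual ℝ V → ℝ} {u : ℝ → V} {K : ℝ}

theorem measurableSet_mem_and_le (hF : MeasurableSet (multiGraph F))
    (hP : Measurable fun q : multiGraph F => P q.1.1 q.1.2.1 q.1.2.2) :
    MeasurableSet {q : ℝ × V × (V × StrongDual ℝ V × ℝ) |
      q.2.2.2.1 ∈ F q.1 q.2.1 ∧ q.2.2.2.2 ≤ P q.1 q.2.1 q.2.2.2.1} := by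
  obtain ⟨Q, hQ, hQP⟩ := (MeasurableEmbedding.subtype_coe hF).exists_measurable_extend hP
    fun _ => ⟨0⟩
  let toGraph : ℝ × V × (V × StrongDual ℝ V × ℝ) → ℝ × V × StrongDual ℝ V :=
    fun q => (q.1, q.2.1, q.2.2.2.1)
  have hgraph : Measurable toGraph := by fun_prop
  have hset : toGraph ⁻¹' multiGraph F ∩ {q | q.2.2.2.2 ≤ Q (toGraph q)} =
      {q | q.2.2.2.1 ∈ F q.1 q.2.1 ∧ q.2.2.2.2 ≤ P q.1 q.2.1 q.2.2.2.1} := by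
    ext q
    refine and_congr_right fun hq => ?_
    have hQ_eq : Q (toGraph q) = P q.1 q.2.1 q.2.2.2.1 := congrFun hQP ⟨toGraph q, hq⟩
    rw [mem_ofPred_eq, hQ_eq]
  rw [← hset]
  exact (hgraph hF).inter (measurableSet_le (by fun_prop) (hQ.comp hgraph))

theorem aeJointlyMeasurable_mem_and_le {ν : Measure ℝ} (hF : MeasurableSet (multiGraph F))
    (hP : Measurable fun q : multiGraph F => P q.1.1 q.1.2.1 q.1.2.2) (hu : AEMeasurable u ν) :
    AEJointlyMeasurable (fun t (w : V × StrongDual ℝ V × ℝ) =>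
      w.2.1 ∈ F t (u t) ∧ w.2.2 ≤ P t (u t) w.2.1) ν := by
  refine ⟨fun q => q.2.2.1 ∈ F q.1 (hu.mk u q.1) ∧ q.2.2.2 ≤ P q.1 (hu.mk u q.1) q.2.2.1,
    ?_, hu.ae_eq_mk.mono fun t ht w => by simp only [ht]⟩
  have hmk : Measurable fun q : ℝ × (V × StrongDual ℝ V × ℝ) => (q.1, hu.mk u q.1, q.2) :=
    measurable_fst.prodMk ((hu.measurable_mk.comp measurable_fst).prodMk measurable_snd)
  exact measurableSet_setOfPred.1 (hmk (measurableSet_mem_and_le hF hP))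

theorem ChainRuleInequality.of_measurable_selection [SecondCountableTopology (StrongDual ℝ V)]
    (hchain : ChainRuleInequality T E Ψ F P) (hu : AbsolutelyContinuousOnInterval u 0 T)
    (hbdd : ∃ S : ℝ, ∀ t ∈ Ioo 0 T, E t (u t) ≤ (S : EReal))
    (hΨ : ∀ᵐ t ∂(volume.restrict (Ioo 0 T)), IsCoercivePotential (Ψ (u t)) K)
    (hvel : HasFiniteTimeIntegral T fun t => ENNReal.ofReal (Ψ (u t) (deriv u t)))
    (hmeas : AEJointlyMeasurable (dissipationIntegrand Ψ u) (volume.restrict (Ioo 0 T)))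
    {w : ℝ → V × StrongDual ℝ V × ℝ} (hw : Measurable w)
    (hadm : ∀ᵐ t ∂(volume.restrict (Ioo 0 T)),
      (w t).2.1 ∈ F t (u t) ∧ (w t).2.2 ≤ P t (u t) (w t).2.1)
    (hfin : ∫⁻ t in Ioo 0 T, dissipationIntegrand Ψ u t (w t) < ⊤) :
    AbsContOnIoo (energyAlong E u) 0 T ∧
      ∀ᵐ t ∂(volume.restrict (Ioo 0 T)),
        (w t).2.1 (deriv u t) + (w t).2.2 ≤ deriv (energyAlong E u) t := by
  have hforce : HasFiniteTimeIntegral T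
      fun t => (fenchelConj (Ψ (u t)) (-(w t).2.1)).toENNReal := by
    refine ⟨?_, (lintegral_mono fun t => le_add_self).trans_lt hfin⟩
    refine (hmeas.aemeasurable_comp (w := fun t => (0, (w t).2.1, 0)) (by fun_prop)).congr ?_
    exact hΨ.mono fun t ht => dissipationIntegrand_force ht _
  have hint : Integrable (fun t => (w t).2.1) (volume.restrict (Ioo 0 T)) :=
    integrable_of_enorm_le_const_add hw.snd.fst.aestronglyMeasurable ENNReal.ofReal_ne_top
      (hΨ.mono fun t ht => by simpa using ht.enorm_le_conj (-(w t).2.1)) hforce.2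
  obtain ⟨hac, hder⟩ := hchain u _ hu hint hbdd (hadm.mono fun _ h => h.1) hvel hforce
  refine ⟨hac, ?_⟩
  filter_upwards [hder, hadm] with t ht_der ht_adm
  linarith [ht_adm.2]

variable [BorelSpace V]

theorem hasFiniteTimeIntegral_deriv [CompleteSpace V] [SecondCountableTopology V]
    {μ : ℝ → Measure (V × StrongDual ℝ V × ℝ)} (hμ : IsYoungMeasure T μ)
    (hΨ : ∀ᵐ t ∂(volume.restrict (Ioo 0 T)), IsCoercivePotential (Ψ (u t)) K)
    (hmeas : AEJointlyMeasurable (dissipationIntegrand Ψ u) (volume.restrict (Ioo 0 T)))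
    (hfin : ∫⁻ t in Ioo 0 T, ∫⁻ w, dissipationIntegrand Ψ u t w ∂(μ t) < ⊤)
    (hbary : ∀ᵐ t ∂(volume.restrict (Ioo 0 T)), deriv u t = ∫ w, w.1 ∂(μ t)) :
    HasFiniteTimeIntegral T fun t => ENNReal.ofReal (Ψ (u t) (deriv u t)) := by
  refine ⟨?_, (lintegral_mono_ae ?_).trans_lt hfin⟩
  · refine (hmeas.aemeasurable_comp (w := fun t => (deriv u t, 0, 0)) (by fun_prop)).congr ?_
    exact hΨ.mono fun t ht => dissipationIntegrand_velocity ht _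
  · filter_upwards [hΨ, hbary, ae_restrict_mem measurableSet_Ioo] with t ht_Ψ ht_bary ht
    have := hμ.prob t ht
    rw [ht_bary]
    exact (ht_Ψ.ofReal_map_integral_le measurable_fst.aestronglyMeasurable).trans
      (lintegral_mono fun w => le_self_add)

theorem aeJointlyMeasurable_power_le [CompleteSpace V] [SecondCountableTopology V] (u : ℝ → V)
    (e : ℝ → ℝ) (ν : Measure ℝ) :
    AEJointlyMeasurable (fun t (w : V × StrongDual ℝ V × ℝ) =>
      w.2.1 (deriv u t) + w.2.2 ≤ deriv e t) ν := by
  have hpairing : Measurable fun q : StrongDual ℝ V × V => q.1 q.2 :=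
    isBoundedBilinearMap_apply.continuous.measurable
  refine ⟨fun q => q.2.2.1 (deriv u q.1) + q.2.2.2 ≤ deriv e q.1, ?_, ae_of_all _ fun _ _ => rfl⟩
  have hpower : Measurable fun q : ℝ × (V × StrongDual ℝ V × ℝ) => q.2.2.1 (deriv u q.1) :=
    hpairing.comp (measurable_snd.snd.fst.prodMk ((measurable_deriv u).comp measurable_fst))
  exact measurableSet_setOfPred.1 (measurableSet_le (by fun_prop) (by fun_prop))

theorem propositionB1_general [CompleteSpace V] [SecondCountableTopology (StrongDual ℝ V)]
    (hchain : ChainRuleInequality T E Ψ F P) (hF : MeasurableSet (multiGraph F))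
    (hP : Measurable fun q : multiGraph F => P q.1.1 q.1.2.1 q.1.2.2)
    (hu : AbsolutelyContinuousOnInterval u 0 T)
    (hbdd : ∃ S : ℝ, ∀ t ∈ Ioo 0 T, E t (u t) ≤ (S : EReal))
    (hΨ : ∀ᵐ t ∂(volume.restrict (Ioo 0 T)), IsCoercivePotential (Ψ (u t)) K)
    {μ : ℝ → Measure (V × StrongDual ℝ V × ℝ)} (hμ : IsYoungMeasure T μ)
    (hmeas : AEJointlyMeasurable (dissipationIntegrand Ψ u) (volume.restrict (Ioo 0 T)))
    (hfin : ∫⁻ t in Ioo 0 T, ∫⁻ w, dissipationIntegrand Ψ u t w ∂(μ t) < ⊤)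
    (hbary : ∀ᵐ t ∂(volume.restrict (Ioo 0 T)), deriv u t = ∫ w, w.1 ∂(μ t))
    (hsupp : ∀ᵐ t ∂(volume.restrict (Ioo 0 T)), ∀ w ∈ (μ t).support,
      w.2.1 ∈ F t (u t) ∧ w.2.2 ≤ P t (u t) w.2.1) :
    AbsContOnIoo (energyAlong E u) 0 T ∧
      ∀ᵐ t ∂(volume.restrict (Ioo 0 T)),
        DifferentiableAt ℝ (energyAlong E u) t ∧
        ∫⁻ w, ENNReal.ofReal (w.2.1 (deriv u t) + w.2.2) ∂(μ t) < ⊤ ∧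
        extIntegral (μ t) (fun w => w.2.1 (deriv u t) + w.2.2)
          ≤ ((deriv (energyAlong E u) t : ℝ) : EReal) := by
  have := separableSpace_of_separableSpace_strongDual (𝕜 := ℝ) (X := V)
  have := UniformSpace.secondCountable_of_separable V
  have hprob : ∀ᵐ t ∂(volume.restrict (Ioo 0 T)), IsProbabilityMeasure (μ t) :=
    (ae_restrict_mem measurableSet_Ioo).mono hμ.prob
  have hu_meas : AEMeasurable u (volume.restrict (Ioo 0 T)) :=
    (hu.continuousOn.mono (Ioo_subset_Icc_self.trans Icc_subset_uIcc)).aemeasurable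
      measurableSet_Ioo
  have hadm : ∀ᵐ t ∂(volume.restrict (Ioo 0 T)), ∀ᵐ w ∂(μ t),
      w.2.1 ∈ F t (u t) ∧ w.2.2 ≤ P t (u t) w.2.1 :=
    hsupp.mono fun t ht => mem_of_superset Measure.support_mem_ae ht
  have hvel := hasFiniteTimeIntegral_deriv hμ hΨ hmeas hfin hbary
  obtain ⟨f, hf⟩ := exists_isRandomCurve hprob hμ.meas
  have hpath : ∀ᵐ s, AbsContOnIoo (energyAlong E u) 0 T ∧
      ∀ᵐ t ∂(volume.restrict (Ioo 0 T)),
        (f t s).2.1 (deriv u t) + (f t s).2.2 ≤ deriv (energyAlong E u) t := by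
    filter_upwards [(hf.ae_ae_iff (aeJointlyMeasurable_mem_and_le hF hP hu_meas)).1 hadm,
      hf.ae_lintegral_lt_top hmeas hfin] with s hs_adm hs_fin
    exact hchain.of_measurable_selection hu hbdd hΨ hvel hmeas
      hf.measurable_uncurry.of_uncurry_right hs_adm hs_fin
  obtain ⟨-, hac, -⟩ := hpath.exists
  have hle := (hf.ae_ae_iff (aeJointlyMeasurable_power_le u (energyAlong E u) _)).2
    (hpath.mono fun _ hs => hs.2)
  refine ⟨hac, ?_⟩
  filter_upwards [hle, hac.ae_differentiableAt, hprob] with t ht_le ht_diff _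
  exact ⟨ht_diff, lintegral_ofReal_lt_top_of_ae_le ht_le,
    (extIntegral_mono_ae ht_le).trans_eq (extIntegral_const _)⟩

end ChainRule

/-- The Borel sets of `V × V* × ℝ` are those of the product `σ`-algebra, as `V` and `V*` are
separable. The hypothesis `hmeas` says that the integrand of `hfin` is measurable with respect to
(Lebesgue measurable sets of `(0,T)`) `⊗` (Borel sets) up to a null set of times, so that the
integral makes sense. The integral in the conclusion may be `-∞`; its positive part is finite. -/
theorem propositionB1
    {V : Type*} [NormedAddCommGroup V] [NormedSpace ℝ V] [CompleteSpace V]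
    [TopologicalSpace.SeparableSpace V] [MeasurableSpace V] [BorelSpace V]
    (hV : IsReflexiveSpace V)
    (T : ℝ) (hT : 0 < T)
    (D : Set V) (E : ℝ → V → EReal) (Ψ : V → V → ℝ)
    (F : ℝ → V → Set (StrongDual ℝ V)) (P : ℝ → V → StrongDual ℝ V → ℝ)
    (hΨ : DissipationAssumptions T D E Ψ)
    (hE : EnergyAssumptions T D E Ψ F P)
    (u : ℝ → V) (hu : AbsolutelyContinuousOnInterval u 0 T)
    (hdom : ∀ᵐ t ∂(volume.restrict (Ioo 0 T)), (F t (u t)).Nonempty)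
    (hbdd : ∃ S : ℝ, ∀ t ∈ Ioo 0 T, E t (u t) ≤ (S : EReal))
    (μ : ℝ → Measure (V × StrongDual ℝ V × ℝ)) (hμ : IsYoungMeasure T μ)
    (hmeas : ∃ g : ℝ × (V × StrongDual ℝ V × ℝ) → ENNReal, Measurable g ∧
      ∀ᵐ t ∂(volume.restrict (Ioo 0 T)), ∀ w, dissipationIntegrand Ψ u t w = g (t, w))
    (hfin : ∫⁻ t in Ioo 0 T, ∫⁻ w, dissipationIntegrand Ψ u t w ∂(μ t) < ⊤)
    (hbary : ∀ᵐ t ∂(volume.restrict (Ioo 0 T)), deriv u t = ∫ w, w.1 ∂(μ t))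
    (hsupp : ∀ᵐ t ∂(volume.restrict (Ioo 0 T)), ∀ w ∈ (μ t).support,
      w.2.1 ∈ F t (u t) ∧ w.2.2 ≤ P t (u t) w.2.1) :
    AbsContOnIoo (energyAlong E u) 0 T ∧
      ∀ᵐ t ∂(volume.restrict (Ioo 0 T)),
        DifferentiableAt ℝ (energyAlong E u) t ∧
        ∫⁻ w, ENNReal.ofReal (w.2.1 (deriv u t) + w.2.2) ∂(μ t) < ⊤ ∧
        extIntegral (μ t) (fun w => w.2.1 (deriv u t) + w.2.2)
          ≤ ((deriv (energyAlong E u) t : ℝ) : EReal) := by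
  have := hV.secondCountableTopology_strongDual
  obtain ⟨K, hK⟩ := exists_ae_isCoercivePotential hΨ hE hbdd
  exact propositionB1_general hE.chain_rule hE.graph_borel hE.time_deriv_borel hu hbdd hK hμ hmeas
    hfin hbary hsupp
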